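/- **Setting.** Let $\mathit{Agt}=\{1,\dots,n\}$. Agents act in synchronous rounds (round $m+1$ leads from time $m$ to time $m+1$); the actions of agent $i$ are $\mathtt{decide}_i(0)$, $\mathtt{decide}_i(1)$, $\mathtt{noop}$. An *information-exchange protocol* $\mathcal E$ gives each agent $i$ local states $L_i$, initial states $I_i\subseteq L_i$, messages $M_i$, a map $\mu_i$ sending a local state and an action to the messages in $M_i\cup\{\bot\}$ sent to each agent, and an update map $\delta_i$ from a local state, an action and the tuple of received messages to a new local state. A *failure pattern* is a pair $(\mathcal N,F)$ with $\mathcal N\subseteq \mathit{Agt}$ (the nonfaulty agents) and $F:\mathbb N\times \mathit{Agt}\times \mathit{Agt}\to\{0,1\}$; $F(m,i,j)=0$ means that the message from $i$ to $j$ in round $m+1$ is replaced by $\bot$. $SO(t)$ is the set of failure patterns with $|\mathit{Agt}\setminus\mathcal N|\le t$ such that $F(m,i,j)=0$ implies $i\notin\mathcal N$. An *action protocol* is $P=(P_i:L_i\to\{\mathtt{decide}_i(0),\mathtt{decide}_i(1),\mathtt{noop}\})_i$. In a context $\gamma=(\mathcal E,\mathcal F,\pi)$, where $\mathcal F$ is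 a set of failure patterns and $\pi$ interprets the primitive propositions, $P$ generates the system $\mathcal I_{\gamma,P}$ of all runs, one for each failure pattern in $\mathcal F$ and each choice of initial states; $r_i(m)$ is agent $i$'s local state at time $m$ of $r$. As usual, $K_i\varphi$ holds at $(r,m)$ if $\varphi$ holds at all points $(r',m')$ of the system with $r'_i(m')=r_i(m)$. In an *EBA context*, local states contain components $\mathit{time}_i\in\mathbb N$, $\mathit{init}_i\in\{0,1\}$, $\mathit{decided}_i,\mathit{rd}_i\in\{0,1,\bot\}$, initially $\mathit{time}_i=0$, $\mathit{decided}_i=\mathit{rd}_i=\bot$; each round increases $\mathit{time}_i$ by $1$, preserves $\mathit{init}_i$, sets $\mathit{decided}_i$ to $v$ if $i$ performs $\mathtt{decide}_i(v)$ and leaves it unchanged otherwise, and sets $\mathit{rd}_i$ to a $v$ such that $i$ received a message from an agent performing $\mathtt{decide}(v)$ in that round, or to $\bot$ if there is none; the messages sent when deciding $0$, when deciding $1$ and when not deciding lie in disjoint sets $M^0,M^1,M^2$ with $\bot\notin M^0\cup M^1$. The primitive propositions describe these components and the set $\mathcal N$ (and, below, any further components). **The program $\mathbf P^0$.** Let $\mathit{jdecided}_j=0$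 abbreviate "$\mathit{decided}_j=0$ now and $\mathit{decided}_j=\bot$ at the previous time", and $\mathit{deciding}_j=0$ abbreviate "$\mathit{decided}_j=\bot$ now and $\mathit{decided}_j=0$ at the next time". $\mathbf P^0_i$ is: if $\mathit{decided}_i\ne\bot$ then $\mathtt{noop}$; else if $\mathit{init}_i=0\lor K_i(\bigvee_j \mathit{jdecided}_j=0)$ then $\mathtt{decide}_i(0)$; else if $K_i(\bigwedge_j\neg(\mathit{deciding}_j=0))$ then $\mathtt{decide}_i(1)$; else $\mathtt{noop}$. An action protocol $P$ *implements* $\mathbf P^0$ in $\gamma$ if, at all local states arising in $\mathcal I_{\gamma,P}$, $P_i$ performs the action that $\mathbf P^0_i$ prescribes with its tests evaluated in $\mathcal I_{\gamma,P}$. **Safety.** Agent $i$ *decides $v$ in round $m+1$* of $r$ if $P_i(r_i(m))=\mathtt{decide}_i(v)$. A *0-chain of length $m$* in $r$ is a sequence $i_0,\dots,i_m$ of distinct agents such that $\mathit{init}_{i_0}=0$; for $0\le k\le m$, agent $i_k$ first decides $0$ in round $k+1$; and for $1\le k\le m$, agent $i_k$ receives in round $k$ a message from $i_{k-1}$ telling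 it that $i_{k-1}$ is deciding $0$ (a message in $M^0$). Agent $i$ *has received a 0-chain by $(r,m)$* if, for some $m'\le m$, some 0-chain of length $m'$ in $r$ ends with $i$. A knowledge-based program is *safe with respect to* an EBA context $\gamma$ if, for all its implementations $P$ in $\gamma$, all points $(r,m)$ of $\mathcal I=\mathcal I_{\gamma,P}$ and all agents $i$: 1. if $i$ has not received a 0-chain by $(r,m)$, then there is a point $(r',m)$ of $\mathcal I$ with $r_i(m)=r'_i(m)$ such that all agents have initial preference $1$ in $r'$; 2. if $\mathcal I,(r,m)\models\neg K_i(\bigwedge_j\neg(\mathit{deciding}_j=0))$ and $i$ does not decide before round $m+1$ in $r$, then there are a point $(r',m)$ of $\mathcal I$ with $r_i(m)=r'_i(m)$ such that $i$ is nonfaulty in $r'$, and an agent $j$ nonfaulty in $r'$ that decides $0$ in round $m+1$ of $r'$; moreover, if $m\ge1$, there are a run $r''$ of $\mathcal I$ and an agent $j'$ such that $j$ and $j'$ are nonfaulty in $r''$, $r'_j(m)=r''_j(m)$, and $j'$ decides $0$ in round $m$ of $r''$. **Minimal contexts.** $\gamma_{\min,n,t}$ has failure model $SO(t)$; local states are $\langle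 \mathit{time}_i,\mathit{init}_i,\mathit{decided}_i,\mathit{rd}_i\rangle$, with initial states $\langle 0,\mathit{init}_i,\bot,\bot\rangle$, $\mathit{init}_i\in\{0,1\}$; an agent performing $\mathtt{decide}_i(v)$ sends $v$ to all agents, and otherwise sends $\bot$; the update is as in EBA contexts (with $\mathit{rd}_i=0$ if both $0$ and $1$ are received). **Basic contexts.** $\gamma_{\mathrm{basic},n,t}$ is the same except that local states have a further component $\#1_i\in\{0,\dots,n\}$, initially $0$; an agent that performs $\mathtt{noop}$ with $\mathit{init}_i=1$ and $\mathit{decided}_i=\mathit{rd}_i=\bot$ sends $(\mathit{init},1)$ to all agents; and each round sets $\#1_i$ to the number of messages $(\mathit{init},1)$ that $i$ receives if $i$ has made no decision up to and including that round and receives no message $0$ or $1$ in it, and to $0$ otherwise. **Proposition.** For all $n,t\in\mathbb N$ with $n-t\ge2$, $\mathbf P^0$ is safe with respect to $\gamma_{\min,n,t}$ and with respect to $\gamma_{\mathrm{basic},n,t}$. -/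

import Mathlib

namespace EBA

/-! ### Information exchange, failures, runs -/

/-- The actions of an agent: decide on a value, or do nothing. -/
inductive Action where
  | decide (v : Fin 2)
  | noop
deriving DecidableEq

/-- An information-exchange protocol for the agents `Fin n`. The value `none : Option (Msg i)`
stands for `⊥` (no message); `send i s a j` is the message from `i` to `j`, and `update i s a ρ`
is the new state of `i` when `ρ j` is the message received from `j`. -/
structure InfoExchange (n : ℕ) where
  State : Fin n → Type
  initial : ∀ i, Set (State i)
  Msg : Fin n → Type
  send : ∀ i, State i → Action → Fin n → Option (Msg i)
  update : ∀ i, State i → Action → (∀ j, Option (Msg j)) → State i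

/-- A failure pattern `(𝒩, F)`; `delivered m i j` says whether the message sent from `i` to `j`
in round `m + 1` is delivered. -/
structure FailurePattern (n : ℕ) where
  nonfaulty : Finset (Fin n)
  delivered : ℕ → Fin n → Fin n → Bool

/-- The sending-omissions failure model `SO(t)`. -/
def SO (n t : ℕ) : Set (FailurePattern n) :=
  {α | α.nonfaultyᶜ.card ≤ t ∧ ∀ m i j, α.delivered m i j = false → i ∉ α.nonfaulty}

variable {n : ℕ}

/-- A global state: the state of the environment and the local states of the agents. -/
structure GlobalState (E : InfoExchange n) where
  env : FailurePattern n
  loc : ∀ i, E.State i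

/-- A run is a function from times to global states. -/
abbrev Run (E : InfoExchange n) : Type := ℕ → GlobalState E

/-- An action protocol for `E`. -/
abbrev ActionProtocol (E : InfoExchange n) : Type := ∀ i, E.State i → Action

/-- The set of nonfaulty agents in a run. -/
def Run.nonfaulty {E : InfoExchange n} (r : Run E) : Finset (Fin n) := (r 0).env.nonfaulty

/-- The message that reaches `j` from `i` in round `k + 1`, if the global state at time `k` is `g`
and agents act according to `P`. -/
def received {E : InfoExchange n} (P : ActionProtocol E) (k : ℕ) (g : GlobalState E)
    (i j : Fin n) : Option (E.Msg i) :=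
  if g.env.delivered k i j then E.send i (g.loc i) (P i (g.loc i)) j else none

/-- The global state at time `k + 1`, given the global state `g` at time `k`. -/
def step {E : InfoExchange n} (P : ActionProtocol E) (k : ℕ) (g : GlobalState E) :
    GlobalState E where
  env := g.env
  loc i := E.update i (g.loc i) (P i (g.loc i)) (fun j => received P k g j i)

/-- The system of all runs of `P` with information exchange `E` and failure model `F`. -/
def system (E : InfoExchange n) (F : Set (FailurePattern n)) (P : ActionProtocol E) :
    Set (Run E) :=
  {r | (r 0).env ∈ F ∧ (∀ i, (r 0).loc i ∈ E.initial i) ∧ ∀ k, r (k + 1) = step P k (r k)}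

/-! ### Knowledge and time -/

/-- The language of knowledge and time over the propositions `Φ`. -/
inductive Formula (n : ℕ) (Φ : Type) where
  | atom (p : Φ)
  | neg (φ : Formula n Φ)
  | and (φ ψ : Formula n Φ)
  /-- Conjunction over all agents. -/
  | conj (φ : Fin n → Formula n Φ)
  /-- Agent `i` knows `φ`. -/
  | know (i : Fin n) (φ : Formula n Φ)
  /-- `φ` holds now and at all future times. -/
  | future (φ : Formula n Φ)
  /-- `φ` holds at all times. -/
  | always (φ : Formula n Φ)
  /-- `φ` holds at the next time. -/
  | next (φ : Formula n Φ)
  /-- There is a previous time, and `φ` holds there. -/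
  | prev (φ : Formula n Φ)

namespace Formula

variable {Φ : Type}

def or (φ ψ : Formula n Φ) : Formula n Φ := neg (and (neg φ) (neg ψ))

/-- Disjunction over all agents. -/
def disj (φ : Fin n → Formula n Φ) : Formula n Φ := neg (conj fun j => neg (φ j))

end Formula

/-- An interpreted system: a set of runs, and the set of propositions true at each point. -/
structure InterpretedSystem (E : InfoExchange n) (Φ : Type) where
  runs : Set (Run E)
  interp : Run E → ℕ → Set Φ

variable {E : InfoExchange n} {Φ : Type}

/-- Truth of a formula at the point `(r, m)`. -/
def InterpretedSystem.Sat (I : InterpretedSystem E Φ) : Formula n Φ → Run E → ℕ → Prop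
  | .atom p, r, m => p ∈ I.interp r m
  | .neg φ, r, m => ¬ I.Sat φ r m
  | .and φ ψ, r, m => I.Sat φ r m ∧ I.Sat ψ r m
  | .conj φ, r, m => ∀ j, I.Sat (φ j) r m
  | .know i φ, r, m => ∀ r' ∈ I.runs, ∀ m', (r m).loc i = (r' m').loc i → I.Sat φ r' m'
  | .future φ, r, m => ∀ m', m ≤ m' → I.Sat φ r m'
  | .always φ, r, _ => ∀ m', I.Sat φ r m'
  | .next φ, r, m => I.Sat φ r (m + 1)
  | .prev φ, r, m => 0 < m ∧ I.Sat φ r (m - 1)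

/-- Truth of a formula, whose truth is determined by the local state of agent `i`, at a
local state `s` of agent `i`. -/
def InterpretedSystem.SatLocal (I : InterpretedSystem E Φ) (i : Fin n) (s : E.State i)
    (φ : Formula n Φ) : Prop :=
  ∀ r ∈ I.runs, ∀ m, (r m).loc i = s → I.Sat φ r m

/-! ### Contexts and knowledge-based programs -/

/-- A context: an information-exchange protocol, a failure model, and an interpretation of
propositions. -/
structure Context (n : ℕ) where
  E : InfoExchange n
  failures : Set (FailurePattern n)
  Atom : Type
  interp : Run E → ℕ → Set Atom

/-- The interpreted system generated by an action protocol in a context. -/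
def Context.interpretedSystem (γ : Context n) (P : ActionProtocol γ.E) :
    InterpretedSystem γ.E γ.Atom where
  runs := system γ.E γ.failures P
  interp := γ.interp

/-- Local knowledge-based programs. Tests are meant to be formulas that are determined by the
local state of the agent running the program. -/
inductive LocalProgram (n : ℕ) (Φ : Type) where
  | act (a : Action)
  | ite (φ : Formula n Φ) (p q : LocalProgram n Φ)

/-- A knowledge-based program: a local one for each agent. -/
abbrev KBProgram (n : ℕ) (Φ : Type) : Type := Fin n → LocalProgram n Φ

open Classical in
/-- The action that results from running a local program of agent `i` in the local state `s`,
with its tests interpreted in `I`. -/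
noncomputable def LocalProgram.eval (I : InterpretedSystem E Φ) (i : Fin n) (s : E.State i) :
    LocalProgram n Φ → Action
  | .act a => a
  | .ite φ p q => if I.SatLocal i s φ then p.eval I i s else q.eval I i s

/-- `P` implements the knowledge-based program `B` in the context `γ`: they agree at all local
states that arise in the system generated by `P`. -/
def Implements (γ : Context n) (P : ActionProtocol γ.E) (B : KBProgram n γ.Atom) : Prop :=
  ∀ i, ∀ r ∈ (γ.interpretedSystem P).runs, ∀ m,
    P i ((r m).loc i) = (B i).eval (γ.interpretedSystem P) i ((r m).loc i)

/-! ### EBA contexts -/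

/-- The components that every local state has in an EBA context; `none` stands for `⊥`. -/
structure Core where
  time : ℕ
  init : Fin 2
  decided : Option (Fin 2)
  rd : Option (Fin 2)

/-- The propositions that every EBA context has. -/
inductive EBAProp (n : ℕ) where
  | init (i : Fin n) (v : Fin 2)
  | decided (i : Fin n) (v : Option (Fin 2))
  | time (i : Fin n) (k : ℕ)
  | nonfaulty (i : Fin n)

/-- The meaning of these propositions at the point `(r, m)`, if `core` gives the standard
components of a local state. -/
def EBAProp.Holds (core : ∀ i, E.State i → Core) (r : Run E) (m : ℕ) : EBAProp n → Prop
  | .init i v => (core i ((r m).loc i)).init = v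
  | .decided i v => (core i ((r m).loc i)).decided = v
  | .time i k => (core i ((r m).loc i)).time = k
  | .nonfaulty i => i ∈ r.nonfaulty

/-- An EBA context. `decideMsg i v` (for `v = 0, 1`) and `otherMsg i` are the disjoint sets
`M⁰`, `M¹`, `M²` of messages of agent `i`, from which a receiver can tell whether `i` is deciding
`0`, deciding `1`, or not deciding. -/
structure EBAContext (n : ℕ) extends Context n where
  core : ∀ i, E.State i → Core
  core_initial : ∀ i, ∀ s ∈ E.initial i,
    (core i s).time = 0 ∧ (core i s).decided = none ∧ (core i s).rd = none
  decideMsg : ∀ i, Fin 2 → Set (Option (E.Msg i))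
  otherMsg : ∀ i, Set (Option (E.Msg i))
  disjoint_decideMsg : ∀ i, Disjoint (decideMsg i 0) (decideMsg i 1)
  disjoint_otherMsg : ∀ i v, Disjoint (decideMsg i v) (otherMsg i)
  none_notMem_decideMsg : ∀ i v, none ∉ decideMsg i v
  send_decide : ∀ i s v j, E.send i s (.decide v) j ∈ decideMsg i v
  send_noop : ∀ i s j, E.send i s .noop j ∈ otherMsg i
  update_time : ∀ i s a ρ, (core i (E.update i s a ρ)).time = (core i s).time + 1
  update_init : ∀ i s a ρ, (core i (E.update i s a ρ)).init = (core i s).init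
  update_decide : ∀ i s v ρ, (core i (E.update i s (.decide v) ρ)).decided = some v
  update_noop : ∀ i s ρ, (core i (E.update i s .noop ρ)).decided = (core i s).decided
  /-- `rd` becomes `v` only if a message saying that its sender is deciding `v` is received. -/
  update_rd_some : ∀ i s a ρ v,
    (core i (E.update i s a ρ)).rd = some v → ∃ j, ρ j ∈ decideMsg j v
  /-- `rd` becomes `⊥` only if no message saying that its sender is deciding is received. -/
  update_rd_none : ∀ i s a ρ,
    (core i (E.update i s a ρ)).rd = none → ∀ j v, ρ j ∉ decideMsg j v
  base : EBAProp n → Atom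
  base_mem_interp : ∀ r m p, base p ∈ interp r m ↔ p.Holds core r m

namespace EBAContext

variable (γ : EBAContext n)

/-- `init_i = v` -/
def initEq (i : Fin n) (v : Fin 2) : Formula n γ.Atom := .atom (γ.base (.init i v))

/-- `decided_i = v`, where `v` may be `⊥` -/
def decidedEq (i : Fin n) (v : Option (Fin 2)) : Formula n γ.Atom :=
  .atom (γ.base (.decided i v))

/-- `jdecided_i = v`: agent `i` has just decided `v` -/
def jdecidedEq (i : Fin n) (v : Fin 2) : Formula n γ.Atom :=
  .and (γ.decidedEq i (some v)) (.prev (γ.decidedEq i none))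

/-- `deciding_i = v`: agent `i` is deciding `v` in the current round -/
def decidingEq (i : Fin n) (v : Fin 2) : Formula n γ.Atom :=
  .and (γ.decidedEq i none) (.next (γ.decidedEq i (some v)))

/-- `K_i` of "no agent is deciding `0`" -/
def knowNoneDecidingZero (i : Fin n) : Formula n γ.Atom :=
  .know i (.conj fun j => .neg (γ.decidingEq j 0))

/-- The knowledge-based program `𝐏⁰`. -/
def P0 : KBProgram n γ.Atom := fun i =>
  .ite (.neg (γ.decidedEq i none)) (.act .noop)
    (.ite ((γ.initEq i 0).or (.know i (.disj fun j => γ.jdecidedEq j 0))) (.act (.decide 0))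
      (.ite (γ.knowNoneDecidingZero i) (.act (.decide 1))
        (.act .noop)))

/-- Agent `i` decides `v` in round `m + 1` of the run `r` of `P`. -/
def Decides (P : ActionProtocol γ.E) (r : Run γ.E) (i : Fin n) (v : Fin 2) (m : ℕ) : Prop :=
  P i ((r m).loc i) = .decide v

/-- The agents `c 0, …, c m` form a `0`-chain of length `m` in the run `r` of `P`: they are
distinct, `c 0` has initial preference `0`, each `c k` first decides `0` in round `k + 1`, and
`c (k + 1)` receives in round `k + 1` a message from `c k` that tells it that `c k` is
deciding `0`. -/
structure IsZeroChain (P : ActionProtocol γ.E) (r : Run γ.E) (m : ℕ)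
    (c : Fin (m + 1) → Fin n) : Prop where
  injective : Function.Injective c
  init_zero : (γ.core (c 0) ((r 0).loc (c 0))).init = 0
  decides : ∀ k : Fin (m + 1), γ.Decides P r (c k) 0 k ∧
    ∀ k' < (k : ℕ), ¬ γ.Decides P r (c k) 0 k'
  hears : ∀ k : Fin m,
    received P k (r k) (c k.castSucc) (c k.succ) ∈ γ.decideMsg (c k.castSucc) 0

/-- Agent `i` receives a `0`-chain in round `m` of `r`. -/
def ReceivesZeroChain (P : ActionProtocol γ.E) (r : Run γ.E) (i : Fin n) (m : ℕ) : Prop :=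
  ∃ c : Fin (m + 1) → Fin n, γ.IsZeroChain P r m c ∧ c (Fin.last m) = i

/-- The knowledge-based program `B` is safe with respect to the EBA context `γ`. -/
def Safe (B : KBProgram n γ.Atom) : Prop :=
  ∀ P : ActionProtocol γ.E, Implements γ.toContext P B →
    ∀ r ∈ system γ.E γ.failures P, ∀ (m : ℕ) (i : Fin n),
      ((¬ ∃ m' ≤ m, γ.ReceivesZeroChain P r i m') →
        ∃ r' ∈ system γ.E γ.failures P, (r m).loc i = (r' m).loc i ∧
          ∀ j, (γ.core j ((r' 0).loc j)).init = 1) ∧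
      ((γ.interpretedSystem P).Sat (.neg (γ.knowNoneDecidingZero i)) r m →
        (∀ k < m, ∀ v, ¬ γ.Decides P r i v k) →
        ∃ r' ∈ system γ.E γ.failures P, (r m).loc i = (r' m).loc i ∧ i ∈ r'.nonfaulty ∧
          ∃ j ∈ r'.nonfaulty, γ.Decides P r' j 0 m ∧
            (1 ≤ m → ∃ r'' ∈ system γ.E γ.failures P, ∃ j' : Fin n,
              j ∈ r''.nonfaulty ∧ j' ∈ r''.nonfaulty ∧ (r' m).loc j = (r'' m).loc j ∧
              γ.Decides P r'' j' 0 (m - 1)))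

end EBAContext

/-! ### The minimal and the basic contexts -/

/-- The standard update of the standard components: `got v` says that a message was received
whose sender is deciding `v`. -/
def Core.update (s : Core) (a : Action) (got : Fin 2 → Bool) : Core where
  time := s.time + 1
  init := s.init
  decided := match a with
    | .decide v => some v
    | .noop => s.decided
  rd := if got 0 then some 0 else if got 1 then some 1 else none

/-- Whether the message `x` occurs in a tuple of received messages. -/
def gotMsg {M : Type} [DecidableEq M] (ρ : Fin n → Option M) (x : M) : Bool :=
  decide (∃ j, ρ j = some x)

theorem gotMsg_iff {M : Type} [DecidableEq M] {ρ : Fin n → Option M} {x : M} :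
    gotMsg ρ x = true ↔ ∃ j, ρ j = some x := decide_eq_true_iff

theorem Core.of_update_rd_some {s : Core} {a : Action} {got : Fin 2 → Bool} {v : Fin 2}
    (h : (s.update a got).rd = some v) : got v = true := by
  simp only [Core.update] at h
  split_ifs at h with h0 h1
  · obtain rfl : 0 = v := by simpa using h
    exact h0
  · obtain rfl : 1 = v := by simpa using h
    exact h1

theorem Core.of_update_rd_none {s : Core} {a : Action} {got : Fin 2 → Bool}
    (h : (s.update a got).rd = none) (v : Fin 2) : ¬ got v = true := by
  simp only [Core.update] at h
  split_ifs at h with h0 h1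
  fin_cases v
  · exact h0
  · exact h1

/-- The minimal information-exchange protocol: an agent that decides `v` sends `v` to all agents,
and otherwise no message is sent. -/
def minExchange (n : ℕ) : InfoExchange n where
  State _ := Core
  initial _ := {s | s.time = 0 ∧ s.decided = none ∧ s.rd = none}
  Msg _ := Fin 2
  send _ _ a _ := match a with
    | .decide v => some v
    | .noop => none
  update _ s a ρ := s.update a (gotMsg (M := Fin 2) ρ)

/-- The propositions of the minimal contexts. -/
inductive MinProp (n : ℕ) where
  | base (p : EBAProp n)
  | rd (i : Fin n) (v : Option (Fin 2))

/-- The minimal context for `n` agents, at most `t` of which are faulty. -/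
def minContext (n t : ℕ) : EBAContext n where
  E := minExchange n
  failures := SO n t
  Atom := MinProp n
  interp r m := {p | match p with
    | .base p => p.Holds (E := minExchange n) (fun _ s => s) r m
    | .rd i v => Core.rd ((r m).loc i) = v}
  core _ s := s
  core_initial _ _ hs := id hs
  decideMsg _ v := ({some v} : Set (Option (Fin 2)))
  otherMsg _ := ({none} : Set (Option (Fin 2)))
  disjoint_decideMsg _ := Set.disjoint_singleton.2 (by decide)
  disjoint_otherMsg _ v := Set.disjoint_singleton.2 (Option.some_ne_none v)
  none_notMem_decideMsg _ v h := Option.some_ne_none v (Set.mem_singleton_iff.1 h).symm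
  send_decide _ _ v _ := Set.mem_singleton _
  send_noop _ _ _ := rfl
  update_time _ _ _ _ := rfl
  update_init _ _ _ _ := rfl
  update_decide _ _ _ _ := rfl
  update_noop _ _ _ := rfl
  update_rd_some i s a ρ v h := gotMsg_iff.1 (Core.of_update_rd_some h)
  update_rd_none i s a ρ h j v hj :=
    Core.of_update_rd_none h v (gotMsg_iff.2 ⟨j, hj⟩)
  base := .base
  base_mem_interp _ _ _ := Iff.rfl

/-- The messages of the basic information-exchange protocol; `init1` is `(init, 1)`. -/
inductive BasicMsg where
  | val (v : Fin 2)
  | init1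
deriving DecidableEq

/-- The local states of the basic information-exchange protocol: `ones` counts the messages
`(init, 1)` received in the last round. -/
structure BasicState (n : ℕ) extends Core where
  ones : Fin (n + 1)

/-- The number of messages `(init, 1)` in a tuple of messages. -/
def countInit1 (ρ : Fin n → Option BasicMsg) : Fin (n + 1) :=
  ⟨(Finset.univ.filter fun j => ρ j = some .init1).card,
    Nat.lt_succ_of_le ((Finset.card_le_univ _).trans_eq (Fintype.card_fin n))⟩

/-- The standard components after a round of the basic information-exchange protocol. -/
def basicCore (s : BasicState n) (a : Action) (ρ : Fin n → Option BasicMsg) : Core :=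
  s.toCore.update a fun v => gotMsg ρ (.val v)

/-- The basic information-exchange protocol. -/
def basicExchange (n : ℕ) : InfoExchange n where
  State _ := BasicState n
  initial _ := {s | s.time = 0 ∧ s.decided = none ∧ s.rd = none ∧ s.ones = 0}
  Msg _ := BasicMsg
  send _ s a _ := match a with
    | .decide v => some (.val v)
    | .noop => if s.init = 1 ∧ s.decided = none ∧ s.rd = none then some .init1 else none
  update _ s a ρ :=
    { toCore := basicCore s a ρ
      ones := if (basicCore s a ρ).decided = none ∧ ¬ ∃ j v, ρ j = some (.val v)
        then countInit1 ρ else 0 }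

/-- The propositions of the basic contexts. -/
inductive BasicProp (n : ℕ) where
  | base (p : EBAProp n)
  | rd (i : Fin n) (v : Option (Fin 2))
  | ones (i : Fin n) (k : Fin (n + 1))

/-- The basic context for `n` agents, at most `t` of which are faulty. -/
def basicContext (n t : ℕ) : EBAContext n where
  E := basicExchange n
  failures := SO n t
  Atom := BasicProp n
  interp r m := {p | match p with
    | .base p => p.Holds (E := basicExchange n) (fun _ s => BasicState.toCore s) r m
    | .rd i v => (BasicState.toCore ((r m).loc i)).rd = v
    | .ones i k => BasicState.ones ((r m).loc i) = k}
  core _ s := BasicState.toCore s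
  core_initial _ _ hs := And.imp_right (And.imp_right And.left) hs
  decideMsg _ v := ({some (BasicMsg.val v)} : Set (Option BasicMsg))
  otherMsg _ := ({some .init1, none} : Set (Option BasicMsg))
  disjoint_decideMsg _ := Set.disjoint_singleton.2 (by decide)
  disjoint_otherMsg _ v := Set.disjoint_singleton_left.2 (by simp)
  none_notMem_decideMsg _ v h := Option.some_ne_none _ (Set.mem_singleton_iff.1 h).symm
  send_decide _ _ v _ := Set.mem_singleton _
  send_noop _ s _ := by
    change (if _ then some BasicMsg.init1 else none) ∈ ({some .init1, none} : Set (Option BasicMsg))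
    split_ifs <;> simp
  update_time _ _ _ _ := rfl
  update_init _ _ _ _ := rfl
  update_decide _ _ _ _ := rfl
  update_noop _ _ _ := rfl
  update_rd_some i s a ρ v h := gotMsg_iff.1 (Core.of_update_rd_some h)
  update_rd_none i s a ρ h j v hj :=
    Core.of_update_rd_none h v (gotMsg_iff.2 ⟨j, hj⟩)
  base := .base
  base_mem_interp _ _ _ := Iff.rfl

end EBA

/-! ### Truth at points and generated runs -/

namespace EBA

variable {n t : ℕ}

/-! Both contexts are instances of `LimitedExchange`, and safety (`safe_P0`) is proved for all such
contexts with `t + 2 ≤ n`.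

The core is that deciding 0 and learning of a 0-chain coincide. An agent that hears a 0 while
undecided knows that somebody has just decided 0, and decides 0. It cannot have decided 1 before,
since deciders of 0 exist at every earlier time of the chain, while deciding 1 requires knowing that
there are none. Conversely (`hears_of_decides_zero`, by strong induction on time), if `i` has not
heard by time `m`, give everybody preference 1 and silence every agent that has heard. Such an agent
decides 0 once and is mute afterwards, and its 0 never reached `i`, so it is faulty and the
silencing is legal and invisible to `i`. Nobody decides 0 in the new run, so `i` does not decide 0
in the old one. The same masked run gives the first condition of safety. Tracing a decider of 0
backwards gives the chain.

For the second condition, take a point that `i` considers possible and at which `j` decides 0,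
ending a chain `c 0, …, c m`. The run is rebuilt from the chain alone (`chainStart`), with a set `S`
of nonfaulty agents that avoids the earlier members. If `i` decides 0, its state is determined by
that fact, so `i` itself plays the role of `j`. Otherwise, at positive times, its state depends only
on the number of agents still waiting that reach it. These agents include all nonfaulty ones, so
there are at least `n - t ≥ 2` of them, and `S` can have the same size and contain both `i` and `j`.
The clause about the preceding round comes from a similar rebuilding in which the last two members
of the chain are nonfaulty. -/

theorem InterpretedSystem.satLocal_iff {E : InfoExchange n} {Φ : Type}
    {I : InterpretedSystem E Φ} {i : Fin n} {φ : Formula n Φ} {r : Run E} (hr : r ∈ I.runs) {m : ℕ}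
    (h : ∀ r' ∈ I.runs, ∀ m', (r' m').loc i = (r m).loc i → I.Sat φ r m → I.Sat φ r' m') :
    I.SatLocal i ((r m).loc i) φ ↔ I.Sat φ r m :=
  ⟨fun H => H r hr m rfl, fun H r' hr' m' e => h r' hr' m' e H⟩

theorem InterpretedSystem.sat_or {E : InfoExchange n} {Φ : Type}
    {I : InterpretedSystem E Φ} {φ ψ : Formula n Φ} {r : Run E} {m : ℕ} :
    I.Sat (φ.or ψ) r m ↔ I.Sat φ r m ∨ I.Sat ψ r m := by
  simp only [Formula.or, InterpretedSystem.Sat]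
  tauto

theorem InterpretedSystem.sat_disj {E : InfoExchange n} {Φ : Type}
    {I : InterpretedSystem E Φ} {φ : Fin n → Formula n Φ} {r : Run E} {m : ℕ} :
    I.Sat (Formula.disj φ) r m ↔ ∃ j, I.Sat (φ j) r m := by
  simp only [Formula.disj, InterpretedSystem.Sat]
  push Not
  rfl

/-- The run of `P` that starts in the global state `g`. -/
def runFrom {E : InfoExchange n} (P : ActionProtocol E) (g : GlobalState E) : Run E :=
  fun m => Nat.rec g (fun k => step P k) m

theorem runFrom_mem_system {E : InfoExchange n} {F : Set (FailurePattern n)}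
    {P : ActionProtocol E} {g : GlobalState E} (hF : g.env ∈ F)
    (hI : ∀ i, g.loc i ∈ E.initial i) : runFrom P g ∈ system E F P :=
  ⟨hF, hI, fun _ => rfl⟩

theorem env_eq_of_mem_system {E : InfoExchange n} {F : Set (FailurePattern n)}
    {P : ActionProtocol E} {r : Run E} (hr : r ∈ system E F P) (m : ℕ) :
    (r m).env = (r 0).env := by
  induction m with
  | zero => rfl
  | succ k ih => rw [hr.2.2 k]; exact ih

theorem loc_succ_of_mem_system {E : InfoExchange n} {F : Set (FailurePattern n)}
    {P : ActionProtocol E} {r : Run E} (hr : r ∈ system E F P) (m : ℕ) (i : Fin n) :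
    (r (m + 1)).loc i =
      E.update i ((r m).loc i) (P i ((r m).loc i)) (fun j => received P m (r m) j i) := by
  rw [hr.2.2 m]; rfl

namespace EBAContext

variable {γ : EBAContext n}

/-- The standard components of the local state of agent `i` at the point `(r, m)`. -/
abbrev coreAt (γ : EBAContext n) (r : Run γ.E) (m : ℕ) (i : Fin n) : Core :=
  γ.core i ((r m).loc i)

variable {P : ActionProtocol γ.E} {r r' : Run γ.E} {m : ℕ} {i j : Fin n}

theorem sat_decidedEq {v : Option (Fin 2)} :
    (γ.interpretedSystem P).Sat (γ.decidedEq i v) r m ↔ (γ.coreAt r m i).decided = v :=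
  γ.base_mem_interp r m _

theorem sat_initEq {v : Fin 2} :
    (γ.interpretedSystem P).Sat (γ.initEq i v) r m ↔ (γ.coreAt r m i).init = v :=
  γ.base_mem_interp r m _

theorem sat_jdecidedEq {v : Fin 2} :
    (γ.interpretedSystem P).Sat (γ.jdecidedEq i v) r m ↔
      (γ.coreAt r m i).decided = some v ∧ 0 < m ∧ (γ.coreAt r (m - 1) i).decided = none := by
  rw [← sat_decidedEq (P := P), ← sat_decidedEq (P := P)]
  rfl

theorem sat_decidingEq {v : Fin 2} :
    (γ.interpretedSystem P).Sat (γ.decidingEq i v) r m ↔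
      (γ.coreAt r m i).decided = none ∧ (γ.coreAt r (m + 1) i).decided = some v := by
  rw [← sat_decidedEq (P := P), ← sat_decidedEq (P := P)]
  rfl

/-! ### Facts about runs -/

theorem time_eq (hr : r ∈ system γ.E γ.failures P) (m : ℕ) (i : Fin n) :
    (γ.coreAt r m i).time = m := by
  induction m with
  | zero => exact (γ.core_initial i _ (hr.2.1 i)).1
  | succ k ih => rw [coreAt, loc_succ_of_mem_system hr, γ.update_time]; exact congrArg (· + 1) ih

theorem init_eq (hr : r ∈ system γ.E γ.failures P) (m : ℕ) (i : Fin n) :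
    (γ.coreAt r m i).init = (γ.coreAt r 0 i).init := by
  induction m with
  | zero => rfl
  | succ k ih => rw [coreAt, loc_succ_of_mem_system hr, γ.update_init]; exact ih

theorem decided_succ_of_decides (hr : r ∈ system γ.E γ.failures P) {v : Fin 2}
    (h : γ.Decides P r i v m) : (γ.coreAt r (m + 1) i).decided = some v := by
  rw [coreAt, loc_succ_of_mem_system hr, show P i ((r m).loc i) = .decide v from h,
    γ.update_decide]

theorem decided_succ_of_noop (hr : r ∈ system γ.E γ.failures P)
    (h : P i ((r m).loc i) = .noop) :
    (γ.coreAt r (m + 1) i).decided = (γ.coreAt r m i).decided := by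
  rw [coreAt, loc_succ_of_mem_system hr, h, γ.update_noop]

theorem exists_decides_of_decided (hr : r ∈ system γ.E γ.failures P) {v : Fin 2}
    (h : (γ.coreAt r m i).decided = some v) : ∃ k < m, γ.Decides P r i v k := by
  induction m with
  | zero => simp [(γ.core_initial i _ (hr.2.1 i)).2.1] at h
  | succ k ih =>
    rcases ha : P i ((r k).loc i) with w | _
    · rw [decided_succ_of_decides hr ha] at h
      obtain rfl : w = v := by simpa using h
      exact ⟨k, k.lt_succ_self, ha⟩
    · rw [decided_succ_of_noop hr ha] at h
      obtain ⟨k', hk', h'⟩ := ih h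
      exact ⟨k', hk'.trans k.lt_succ_self, h'⟩

theorem decided_eq_none (hr : r ∈ system γ.E γ.failures P)
    (h : ∀ k < m, ∀ v, ¬ γ.Decides P r i v k) : (γ.coreAt r m i).decided = none := by
  rcases hd : (γ.coreAt r m i).decided with _ | v
  · rfl
  · obtain ⟨k, hk, h'⟩ := exists_decides_of_decided hr hd
    exact (h k hk v h').elim

theorem decides_of_received_mem {v : Fin 2}
    (h : received P m (r m) j i ∈ γ.decideMsg j v) :
    γ.Decides P r j v m ∧ (r m).env.delivered m j i = true := by
  unfold received at h
  split_ifs at h with hd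
  · refine ⟨?_, hd⟩
    unfold Decides
    rcases ha : P j ((r m).loc j) with w | _
    · rw [ha] at h
      have hw := γ.send_decide j ((r m).loc j) w i
      by_cases hvw : w = v
      · rw [hvw]
      · have hdis : Disjoint (γ.decideMsg j v) (γ.decideMsg j w) := by
          have h01 := γ.disjoint_decideMsg j
          fin_cases v <;> fin_cases w
          · exact (hvw rfl).elim
          · exact h01
          · exact h01.symm
          · exact (hvw rfl).elim
        exact (Set.disjoint_left.1 hdis h hw).elim
    · rw [ha] at h
      exact (Set.disjoint_left.1 (γ.disjoint_otherMsg j v) h (γ.send_noop j _ i)).elim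
  · exact (γ.none_notMem_decideMsg j v h).elim

theorem received_mem_of_decides {v : Fin 2} (h : γ.Decides P r j v m)
    (hd : (r m).env.delivered m j i = true) :
    received P m (r m) j i ∈ γ.decideMsg j v := by
  unfold received
  rw [if_pos hd, show P j ((r m).loc j) = .decide v from h]
  exact γ.send_decide _ _ _ _

theorem exists_received_of_rd (hr : r ∈ system γ.E γ.failures P) {v : Fin 2}
    (h : (γ.coreAt r m i).rd = some v) :
    ∃ k, m = k + 1 ∧ ∃ j, received P k (r k) j i ∈ γ.decideMsg j v := by
  cases m with
  | zero => simp [(γ.core_initial i _ (hr.2.1 i)).2.2] at h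
  | succ k =>
    rw [coreAt, loc_succ_of_mem_system hr] at h
    exact ⟨k, rfl, γ.update_rd_some _ _ _ _ _ h⟩

theorem decides_of_sat_decidingEq (hr : r ∈ system γ.E γ.failures P) {v : Fin 2}
    (h : (γ.interpretedSystem P).Sat (γ.decidingEq i v) r m) : γ.Decides P r i v m := by
  obtain ⟨h0, h1⟩ := sat_decidingEq.1 h
  rcases ha : P i ((r m).loc i) with w | _
  · rw [decided_succ_of_decides hr ha] at h1
    obtain rfl : w = v := by simpa using h1
    exact ha
  · rw [decided_succ_of_noop hr ha, h0] at h1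
    cases h1

theorem decides_of_sat_jdecidedEq (hr : r ∈ system γ.E γ.failures P) {v : Fin 2}
    (h : (γ.interpretedSystem P).Sat (γ.jdecidedEq i v) r (m + 1)) : γ.Decides P r i v m := by
  obtain ⟨h1, -, h0⟩ := sat_jdecidedEq.1 h
  exact decides_of_sat_decidingEq hr (sat_decidingEq.2 ⟨h0, h1⟩)

/-! ### The actions of implementations of `𝐏⁰` -/

open Classical in
-- Each test of the program depends only on the local state of `i`, so its truth at all points with
-- that state reduces to its truth at the given point.
theorem implements_P0_eq (hP : Implements γ.toContext P γ.P0)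
    (hr : r ∈ system γ.E γ.failures P) (m : ℕ) (i : Fin n) :
    P i ((r m).loc i) =
      if (γ.coreAt r m i).decided ≠ none then .noop
      else if (γ.coreAt r m i).init = 0 ∨
          (γ.interpretedSystem P).Sat (.know i (.disj fun j => γ.jdecidedEq j 0)) r m then .decide 0
      else if (γ.interpretedSystem P).Sat (γ.knowNoneDecidingZero i) r m then .decide 1
      else .noop := by
  have hr' : r ∈ (γ.interpretedSystem P).runs := hr
  rw [hP i r hr m]
  simp only [P0, LocalProgram.eval]
  rw [InterpretedSystem.satLocal_iff hr', InterpretedSystem.satLocal_iff hr',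
    InterpretedSystem.satLocal_iff hr', InterpretedSystem.sat_or, sat_initEq]
  · refine if_congr (not_congr sat_decidedEq) rfl ?_
    congr
  · intro r' _ m' e H r'' hr'' m'' e'
    exact H r'' hr'' m'' (e.symm.trans e')
  · intro r' _ m' e
    rw [InterpretedSystem.sat_or, InterpretedSystem.sat_or, sat_initEq, sat_initEq, coreAt, coreAt, e]
    exact Or.imp_right fun H r'' hr'' m'' e' => H r'' hr'' m'' (e.symm.trans e')
  · intro r' _ m' e H H'
    exact H (sat_decidedEq.2 (by rw [coreAt, ← e]; exact sat_decidedEq.1 H'))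

section Implementation

variable (hP : Implements γ.toContext P γ.P0) (hr : r ∈ system γ.E γ.failures P)
include hP hr

theorem decided_eq_none_of_decides {v : Fin 2} (h : γ.Decides P r i v m) :
    (γ.coreAt r m i).decided = none := by
  by_contra hd
  have := implements_P0_eq hP hr m i
  rw [if_pos hd, show P i ((r m).loc i) = .decide v from h] at this
  cases this

theorem decided_ne_none_of_decides {v : Fin 2} {k : ℕ} (h : γ.Decides P r i v k) (hk : k < m) :
    (γ.coreAt r m i).decided ≠ none := by
  induction m, hk using Nat.le_induction with
  | base => rw [decided_succ_of_decides hr h]; exact Option.some_ne_none v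
  | succ m _ ih =>
    have := implements_P0_eq hP hr m i
    rw [if_pos ih] at this
    rwa [decided_succ_of_noop hr this]

theorem decides_time_unique {v w : Fin 2} {k : ℕ} (h : γ.Decides P r i v k)
    (h' : γ.Decides P r i w m) : k = m := by
  rcases lt_trichotomy k m with hk | hk | hk
  · exact (decided_ne_none_of_decides hP hr h hk (decided_eq_none_of_decides hP hr h')).elim
  · exact hk
  · exact (decided_ne_none_of_decides hP hr h' hk (decided_eq_none_of_decides hP hr h)).elim

theorem decides_zero_iff : γ.Decides P r i 0 m ↔ (γ.coreAt r m i).decided = none ∧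
    ((γ.coreAt r m i).init = 0 ∨
      (γ.interpretedSystem P).Sat (.know i (.disj fun j => γ.jdecidedEq j 0)) r m) := by
  unfold Decides
  rw [implements_P0_eq hP hr m i]
  split_ifs with h1 h2 h3 <;> simp_all

/-- Deciding 1 requires knowing that nobody is deciding 0 in this round, and knowledge is truthful.
-/
theorem not_decides_zero_of_decides_one (h : γ.Decides P r i 1 m) :
    ¬ γ.Decides P r j 0 m := by
  intro hj
  have hk : (γ.interpretedSystem P).Sat (γ.knowNoneDecidingZero i) r m := by
    have := implements_P0_eq hP hr m i
    rw [show P i ((r m).loc i) = .decide 1 from h] at this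
    split_ifs at this with h1 h2 h3
    · simp at this
    · exact h3
  exact hk r hr m rfl j (sat_decidingEq.2
    ⟨decided_eq_none_of_decides hP hr hj, decided_succ_of_decides hr hj⟩)

/-- Nobody decides `0` in a run in which all initial preferences are `1`. -/
theorem not_decides_zero_of_init_one (h1 : ∀ j, (γ.coreAt r 0 j).init = 1) (m : ℕ) (i : Fin n) :
    ¬ γ.Decides P r i 0 m := by
  induction m generalizing i with
  | zero =>
    intro h
    obtain ⟨-, h | h⟩ := (decides_zero_iff hP hr).1 h
    · simp [h1] at h
    · obtain ⟨j, hj⟩ := InterpretedSystem.sat_disj.1 (h r hr 0 rfl)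
      exact absurd (sat_jdecidedEq.1 hj).2.1 (lt_irrefl 0)
  | succ k ih =>
    intro h
    obtain ⟨-, h | h⟩ := (decides_zero_iff hP hr).1 h
    · simp [init_eq hr, h1] at h
    · obtain ⟨j, hj⟩ := InterpretedSystem.sat_disj.1 (h r hr _ rfl)
      exact ih j (decides_of_sat_jdecidedEq hr hj)

end Implementation

/-- EBA contexts with sending omissions in which little information is exchanged. Agents that have
decided are silent; an undecided agent with initial preference `1` that has not heard of a decision
sends the same message `idle` to all agents at all times. A state records who sent which message
only to the extent of `update_heard` and `update_quiet`. -/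
structure LimitedExchange (γ : EBAContext n) (t : ℕ) where
  failures_eq : γ.failures = SO n t
  exists_initial : ∀ i v, ∃ s ∈ γ.E.initial i, (γ.core i s).init = v
  initial_ext : ∀ i, ∀ s ∈ γ.E.initial i, ∀ s' ∈ γ.E.initial i,
    (γ.core i s).init = (γ.core i s').init → s = s'
  rd_zero : ∀ i s a ρ j, ρ j ∈ γ.decideMsg j 0 → (γ.core i (γ.E.update i s a ρ)).rd = some 0
  send_decided : ∀ i s j, (γ.core i s).decided ≠ none → γ.E.send i s .noop j = none
  idle : ∀ i, Option (γ.E.Msg i)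
  send_idle : ∀ i s j, (γ.core i s).init = 1 → (γ.core i s).decided = none →
    (γ.core i s).rd = none → γ.E.send i s .noop j = idle i
  -- A received 0 hides everything else that arrives in the round.
  update_heard : ∀ i s s' ρ ρ', (γ.core i s).time = (γ.core i s').time →
    (γ.core i s).init = (γ.core i s').init → (γ.core i s).decided = none →
    (γ.core i s').decided = none → (∃ j, ρ j ∈ γ.decideMsg j 0) → (∃ j, ρ' j ∈ γ.decideMsg j 0) →
    γ.E.update i s .noop ρ = γ.E.update i s' .noop ρ'
  -- Asking for equal cardinality only, not for equal senders, is what later permits replacing the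
  -- waiting senders by a chosen set.
  update_quiet : ∀ i s s' (S S' : Finset (Fin n)), (γ.core i s).time = (γ.core i s').time →
    (γ.core i s).init = (γ.core i s').init → (γ.core i s).decided = none →
    (γ.core i s').decided = none → S.card = S'.card →
    γ.E.update i s .noop (fun j => if j ∈ S then idle j else none) =
      γ.E.update i s' .noop (fun j => if j ∈ S' then idle j else none)

/-- At time `m`, agent `i` learns of a `0`-chain: either `m = 0` and its own initial preference is
`0`, or it receives in round `m` a message from an agent that is deciding `0`. -/
def Hears (γ : EBAContext n) (P : ActionProtocol γ.E) (r : Run γ.E) (i : Fin n) : ℕ → Prop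
  | 0 => (γ.coreAt r 0 i).init = 0
  | k + 1 => ∃ j, received P k (r k) j i ∈ γ.decideMsg j 0

theorem init_eq_one_of_not_hears (h : ¬ γ.Hears P r i 0) : (γ.coreAt r 0 i).init = 1 := by
  have h' : (γ.coreAt r 0 i).init ≠ 0 := h
  omega

/-! ### Deciding 0 amounts to learning of a 0-chain -/

section Implementation

variable (T : LimitedExchange γ t) (hP : Implements γ.toContext P γ.P0)
include T hP

omit hP in
theorem rd_zero_of_hears_succ (hr : r ∈ system γ.E γ.failures P) (h : γ.Hears P r i (m + 1)) :
    (γ.coreAt r (m + 1) i).rd = some 0 := by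
  obtain ⟨j, hj⟩ := h
  rw [coreAt, loc_succ_of_mem_system hr]
  exact T.rd_zero _ _ _ _ j hj

omit T in
-- At every point with this local state `rd = 0` too, so some sender has just decided 0 there; hence
-- the agent knows that somebody has.
theorem decides_zero_of_rd_zero (hr : r ∈ system γ.E γ.failures P)
    (hd : (γ.coreAt r m i).decided = none) (h : (γ.coreAt r m i).rd = some 0) :
    γ.Decides P r i 0 m := by
  refine (decides_zero_iff hP hr).2 ⟨hd, .inr ?_⟩
  intro r' hr' m' e
  rw [coreAt, e] at h
  obtain ⟨k, rfl, j, hj⟩ := exists_received_of_rd hr' h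
  have hj' := (decides_of_received_mem hj).1
  exact InterpretedSystem.sat_disj.2 ⟨j, sat_jdecidedEq.2 ⟨decided_succ_of_decides hr' hj',
    k.succ_pos, decided_eq_none_of_decides hP hr' hj'⟩⟩

omit T hP in
/-- If up to time `m` agents decide `0` only when they learn of a `0`-chain, and an agent decides
`0` at time `m`, then some agent does so at every earlier time. -/
theorem exists_decides_zero_of_le (h : ∀ k ≤ m, ∀ j, γ.Decides P r j 0 k → γ.Hears P r j k)
    (hi : γ.Decides P r i 0 m) : ∀ k ≤ m, ∃ j, γ.Decides P r j 0 k := by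
  intro k hk
  induction m generalizing i with
  | zero => exact ⟨i, by rwa [Nat.le_zero.1 hk]⟩
  | succ m ih =>
    rcases Nat.lt_or_ge m k with hlt | hle
    · exact ⟨i, by rwa [show k = m + 1 by omega]⟩
    · obtain ⟨j, hj⟩ := h _ le_rfl i hi
      exact ih (fun k' hk' => h k' (by omega)) (decides_of_received_mem hj).1 hle

/-- An earlier decision for 1 is impossible: the decider of 0 that is heard traces back to deciders
of 0 at all earlier times. The hypothesis `h` covers only times below `m`, because the lemma is used
inside the induction that establishes it. -/
theorem exists_decides_zero_of_hears (hr : r ∈ system γ.E γ.failures P)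
    (h : ∀ k < m, ∀ j, γ.Decides P r j 0 k → γ.Hears P r j k)
    (hi : γ.Hears P r i m) : ∃ k ≤ m, γ.Decides P r i 0 k := by
  cases m with
  | zero => exact ⟨0, le_rfl, (decides_zero_iff hP hr).2
      ⟨(γ.core_initial i _ (hr.2.1 i)).2.1, .inl hi⟩⟩
  | succ m =>
    rcases hd : (γ.coreAt r (m + 1) i).decided with _ | v
    · exact ⟨_, le_rfl, decides_zero_of_rd_zero hP hr hd (rd_zero_of_hears_succ T hr hi)⟩
    · obtain ⟨k, hk, hv⟩ := exists_decides_of_decided hr hd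
      obtain ⟨j, hj⟩ := hi
      obtain ⟨j', hj'⟩ := exists_decides_zero_of_le (fun k hk => h k (by omega))
        (decides_of_received_mem hj).1 k (by omega)
      obtain rfl : v = 0 := by
        by_contra hv0
        obtain rfl : v = 1 := by omega
        exact not_decides_zero_of_decides_one hP hr hv hj'
      exact ⟨k, hk.le, hv⟩

open Classical in
/-- The global state in which everyone has initial preference `1`, agents fail as in `r`, and up to
time `m` agents that have learnt of a `0`-chain in `r` omit all messages. -/
noncomputable def maskedStart (T : LimitedExchange γ t) (P : ActionProtocol γ.E) (r : Run γ.E)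
    (m : ℕ) : GlobalState γ.E where
  env :=
    { nonfaulty := r.nonfaulty
      delivered := fun k j l => (r 0).env.delivered k j l &&
        decide (k < m → ∀ k' ≤ k, ¬ γ.Hears P r j k') }
  loc i := if (γ.coreAt r 0 i).init = 1 then (r 0).loc i else (T.exists_initial i 1).choose

omit hP in
theorem init_maskedStart (i : Fin n) :
    (γ.core i ((maskedStart T P r m).loc i)).init = 1 := by
  simp only [maskedStart]
  split_ifs with h
  · exact h
  · exact (T.exists_initial i 1).choose_spec.2

theorem maskedStart_mem_system (hr : r ∈ system γ.E γ.failures P)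
    (h : ∀ k < m, ∀ j, γ.Decides P r j 0 k → γ.Hears P r j k)
    (hi : ∀ k ≤ m, ¬ γ.Hears P r i k) :
    runFrom P (maskedStart T P r m) ∈ system γ.E γ.failures P := by
  have hF : (r 0).env ∈ SO n t := T.failures_eq ▸ hr.1
  refine runFrom_mem_system ?_ fun l => ?_
  · rw [T.failures_eq]
    refine ⟨hF.1, fun k j l hd hj => ?_⟩
    have hdel : ∀ k l, (r 0).env.delivered k j l = true := fun k l => by
      by_contra hn
      exact hF.2 k j l (by simpa using hn) hj
    simp only [maskedStart, hdel, Bool.true_and, decide_eq_false_iff_not] at hd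
    push Not at hd
    obtain ⟨hkm, k', hk', hh⟩ := hd
    -- A nonfaulty `j` that has heard would have sent its 0 to `i` in round `k'' + 1`. The bound `k
    -- < m` in the mask ensures that this round is at most `m`.
    obtain ⟨k'', hk'', hz⟩ := exists_decides_zero_of_hears T hP hr (fun k hk => h k (by omega)) hh
    refine hi (k'' + 1) (by omega) ⟨j, received_mem_of_decides hz ?_⟩
    rw [env_eq_of_mem_system hr]
    exact hdel _ _
  · simp only [maskedStart]
    split_ifs
    · exact hr.2.1 l
    · exact (T.exists_initial l 1).choose_spec.1

/-- The statement is for all agents that have not yet heard, since the induction needs the states of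
the senders as well as that of the receiver. -/
theorem runFrom_maskedStart_loc_eq (hr : r ∈ system γ.E γ.failures P)
    (h : ∀ k < m, ∀ j, γ.Decides P r j 0 k → γ.Hears P r j k)
    (hi : ∀ k ≤ m, ¬ γ.Hears P r i k) {k : ℕ} (hk : k ≤ m) (l : Fin n)
    (hl : ∀ k' ≤ k, ¬ γ.Hears P r l k') :
    (runFrom P (maskedStart T P r m) k).loc l = (r k).loc l := by
  have hr' := maskedStart_mem_system T hP hr h hi
  induction k generalizing l with
  | zero =>
    change (maskedStart T P r m).loc l = _
    simp only [maskedStart]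
    rw [if_pos (init_eq_one_of_not_hears (hl 0 le_rfl))]
  | succ k ih =>
    rw [loc_succ_of_mem_system hr, loc_succ_of_mem_system hr',
      ih (by omega) l fun k' hk' => hl k' (by omega)]
    congr 1
    funext j
    have henv' : (runFrom P (maskedStart T P r m) k).env = (maskedStart T P r m).env :=
      env_eq_of_mem_system hr' k
    by_cases hj : ∀ k' ≤ k, ¬ γ.Hears P r j k'
    · unfold received
      rw [ih (by omega) j hj, henv', env_eq_of_mem_system hr k]
      have hm : (maskedStart T P r m).env.delivered k j l = (r 0).env.delivered k j l := by
        simp only [maskedStart, Bool.and_eq_left_iff_imp, decide_eq_true_iff]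
        exact fun _ _ => hj
      rw [hm]
    · have hm : (maskedStart T P r m).env.delivered k j l = false := by
        simp only [maskedStart, Bool.and_eq_false_iff, decide_eq_false_iff_not]
        exact .inr fun H => hj (H (by omega))
      have hl' : received P k (runFrom P (maskedStart T P r m) k) j l = none := by
        unfold received
        rw [henv', hm]
        rfl
      rw [hl']
      push Not at hj
      obtain ⟨k', hk', hh⟩ := hj
      obtain ⟨k'', hk'', hz⟩ := exists_decides_zero_of_hears T hP hr
        (fun k hk => h k (by omega)) hh
      unfold received
      split_ifs with hd
      · rcases (show k'' ≤ k by omega).eq_or_lt with rfl | hlt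
        · exact (hl (k'' + 1) le_rfl ⟨j, received_mem_of_decides hz hd⟩).elim
        · have hdec := decided_ne_none_of_decides hP hr hz hlt
          have hnoop : P j ((r k).loc j) = .noop := by
            rw [implements_P0_eq hP hr k j, if_pos hdec]
          rw [hnoop, T.send_decided _ _ _ hdec]
      · rfl

theorem exists_init_one_of_not_hears_aux (hr : r ∈ system γ.E γ.failures P)
    (h : ∀ k < m, ∀ j, γ.Decides P r j 0 k → γ.Hears P r j k)
    (hi : ∀ k ≤ m, ¬ γ.Hears P r i k) :
    ∃ r' ∈ system γ.E γ.failures P, (r m).loc i = (r' m).loc i ∧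
      ∀ j, (γ.coreAt r' 0 j).init = 1 :=
  ⟨_, maskedStart_mem_system T hP hr h hi,
    (runFrom_maskedStart_loc_eq T hP hr h hi le_rfl i hi).symm, fun j => init_maskedStart T j⟩

variable (hr : r ∈ system γ.E γ.failures P)
include hr

/-- Otherwise the state of `i` also occurs in a run where all preferences are 1, and there the same
action would be a decision for 0. -/
theorem hears_of_decides_zero (hi : γ.Decides P r i 0 m) : γ.Hears P r i m := by
  induction m using Nat.strong_induction_on generalizing i with
  | _ m ih =>
    have ih' : ∀ k < m, ∀ j, γ.Decides P r j 0 k → γ.Hears P r j k := fun k hk j hj => ih k hk hj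
    by_contra hn
    -- Hearing before time `m` would lead to a decision before time `m` and hence to two decisions.
    have hall : ∀ k ≤ m, ¬ γ.Hears P r i k := by
      intro k hk hh
      rcases hk.eq_or_lt with rfl | hlt
      · exact hn hh
      · obtain ⟨k', hk', hz⟩ := exists_decides_zero_of_hears T hP hr
          (fun k hk => ih' k (by omega)) hh
        have := decides_time_unique hP hr hz hi
        omega
    obtain ⟨r', hr', e, h1⟩ := exists_init_one_of_not_hears_aux T hP hr ih' hall
    refine not_decides_zero_of_init_one hP hr' h1 m i ?_
    unfold Decides at hi ⊢
    rwa [← e]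

theorem decides_zero_of_hears (hi : γ.Hears P r i m) : ∃ k ≤ m, γ.Decides P r i 0 k :=
  exists_decides_zero_of_hears T hP hr (fun _ _ _ => hears_of_decides_zero T hP hr) hi

theorem exists_init_one_of_not_hears (hi : ∀ k ≤ m, ¬ γ.Hears P r i k) :
    ∃ r' ∈ system γ.E γ.failures P, (r m).loc i = (r' m).loc i ∧
      ∀ j, (γ.coreAt r' 0 j).init = 1 :=
  exists_init_one_of_not_hears_aux T hP hr (fun _ _ _ => hears_of_decides_zero T hP hr) hi

theorem not_decides_one_of_decides_zero (hi : γ.Decides P r i 0 m) {k : ℕ} (hk : k ≤ m)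
    (j : Fin n) : ¬ γ.Decides P r j 1 k := by
  intro hj
  obtain ⟨l, hl⟩ := exists_decides_zero_of_le
    (fun _ _ _ => hears_of_decides_zero T hP hr) hi k hk
  exact not_decides_zero_of_decides_one hP hr hj hl

/-- The chain is indexed by `ℕ`, with irrelevant values beyond `m`, so that it can be extended and
truncated freely. Distinctness is left out because it follows from agents deciding only once. -/
theorem exists_chain (hi : γ.Decides P r i 0 m) : ∃ c : ℕ → Fin n, c m = i ∧
    (γ.coreAt r 0 (c 0)).init = 0 ∧ (∀ k ≤ m, γ.Decides P r (c k) 0 k) ∧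
      ∀ k < m, received P k (r k) (c k) (c (k + 1)) ∈ γ.decideMsg (c k) 0 := by
  induction m generalizing i with
  | zero =>
    refine ⟨fun _ => i, rfl, hears_of_decides_zero T hP hr hi, fun k hk => ?_, by simp⟩
    rwa [Nat.le_zero.1 hk]
  | succ m ih =>
    obtain ⟨j, hj⟩ := hears_of_decides_zero T hP hr hi
    obtain ⟨c, rfl, h0, hd, hh⟩ := ih (decides_of_received_mem hj).1
    refine ⟨Function.update c (m + 1) i, by simp, by simpa using h0, fun k hk => ?_, fun k hk => ?_⟩
    · rcases eq_or_ne k (m + 1) with rfl | hne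
      · simpa using hi
      · rw [Function.update_of_ne hne]
        exact hd k (by omega)
    · rw [Function.update_of_ne (by omega)]
      rcases eq_or_ne k m with rfl | hne
      · simpa using hj
      · rw [Function.update_of_ne (by omega)]
        exact hh k (by omega)

theorem receivesZeroChain_of_decides_zero (hi : γ.Decides P r i 0 m) :
    γ.ReceivesZeroChain P r i m := by
  obtain ⟨c, hc, h0, hd, hh⟩ := exists_chain T hP hr hi
  refine ⟨fun k => c k, ⟨fun a b hab => ?_, h0, fun k => ⟨hd k (by omega), fun k' hk' h' => ?_⟩,
    fun k => hh k k.2⟩, hc⟩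
  · have ha := hd a (by omega)
    have hb := hd b (by omega)
    rw [show c a = c b from hab] at ha
    exact Fin.ext (decides_time_unique hP hr ha hb)
  · exact hk'.ne (decides_time_unique hP hr h' (hd k (by omega)))

/-- The first condition of safety. -/
theorem exists_init_one_of_not_receivesZeroChain
    (h : ¬ ∃ m' ≤ m, γ.ReceivesZeroChain P r i m') :
    ∃ r' ∈ system γ.E γ.failures P, (r m).loc i = (r' m).loc i ∧
      ∀ j, (γ.coreAt r' 0 j).init = 1 := by
  refine exists_init_one_of_not_hears T hP hr fun k hk hh => h ?_
  obtain ⟨k', hk', hz⟩ := decides_zero_of_hears T hP hr hh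
  exact ⟨k', by omega, receivesZeroChain_of_decides_zero T hP hr hz⟩

end Implementation

/-! ### Local states while 0 is being decided -/

section Implementation

variable (T : LimitedExchange γ t) (hP : Implements γ.toContext P γ.P0)
include T hP

theorem init_eq_one_of_not_decides_zero (hr : r ∈ system γ.E γ.failures P)
    (hi : ¬ γ.Decides P r i 0 0) : (γ.coreAt r 0 i).init = 1 := by
  refine init_eq_one_of_not_hears (P := P) fun h => hi ?_
  obtain ⟨k, hk, hz⟩ := decides_zero_of_hears T hP hr h
  rwa [Nat.le_zero.1 hk] at hz

/-- While others still decide `0`, an agent that has not decided `0` is undecided, has not heard of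
a decision, and waits. -/
theorem waiting_of_not_decides_zero (hr : r ∈ system γ.E γ.failures P)
    (hj : γ.Decides P r j 0 m) (hi : ∀ k ≤ m, ¬ γ.Decides P r i 0 k) :
    (γ.coreAt r m i).init = 1 ∧ (γ.coreAt r m i).decided = none ∧ (γ.coreAt r m i).rd = none ∧
      P i ((r m).loc i) = .noop := by
  -- Somebody decides 0 at each time up to `m`, which excludes decisions for 1 by anyone up to then.
  have key : ∀ k ≤ m, ∀ v, ¬ γ.Decides P r i v k := by
    intro k hk v hv
    rcases (show v = 0 ∨ v = 1 by omega) with rfl | rfl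
    · exact hi k hk hv
    · exact not_decides_one_of_decides_zero T hP hr hj hk i hv
  refine ⟨?_, decided_eq_none hr fun k hk => key k hk.le, ?_, ?_⟩
  · rw [init_eq hr]
    exact init_eq_one_of_not_decides_zero T hP hr (hi 0 (Nat.zero_le m))
  · rcases h : (γ.coreAt r m i).rd with _ | v
    · rfl
    · obtain ⟨k, rfl, l, hl⟩ := exists_received_of_rd hr h
      rcases (show v = 0 ∨ v = 1 by omega) with rfl | rfl
      · obtain ⟨k', hk', hz⟩ := decides_zero_of_hears T hP hr
          (show γ.Hears P r i (k + 1) from ⟨l, hl⟩)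
        exact (hi k' hk' hz).elim
      · exact (not_decides_one_of_decides_zero T hP hr hj k.le_succ l
          (decides_of_received_mem hl).1).elim
  · rcases h : P i ((r m).loc i) with v | _
    · exact (key m le_rfl v h).elim
    · rfl

open Classical in
/-- The agents from which `i` receives the message of round `m + 1` and that have not decided `0`
in that round or before. -/
noncomputable def waitingSenders (P : ActionProtocol γ.E) (r : Run γ.E) (m : ℕ) (i : Fin n) :
    Finset (Fin n) :=
  Finset.univ.filter fun l => (r m).env.delivered m l i = true ∧ ∀ k ≤ m, ¬ γ.Decides P r l 0 k

omit T hP in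
theorem mem_waitingSenders {l : Fin n} : l ∈ waitingSenders P r m i ↔
    (r m).env.delivered m l i = true ∧ ∀ k ≤ m, ¬ γ.Decides P r l 0 k := by
  simp [waitingSenders]

/-- A sender that decided 0 earlier is mute, one deciding 0 now cannot be delivered to `i`, and
every other sender is idle. -/
theorem received_eq_of_not_decides_zero (hr : r ∈ system γ.E γ.failures P)
    (hj : γ.Decides P r j 0 m) (hi : ∀ k ≤ m + 1, ¬ γ.Decides P r i 0 k) :
    (fun l => received P m (r m) l i) =
      fun l => if l ∈ waitingSenders P r m i then T.idle l else none := by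
  funext l
  unfold received
  by_cases hd : (r m).env.delivered m l i = true
  · rw [if_pos hd]
    by_cases hl : ∀ k ≤ m, ¬ γ.Decides P r l 0 k
    · rw [if_pos (mem_waitingSenders.2 ⟨hd, hl⟩)]
      obtain ⟨h1, h2, h3, h4⟩ := waiting_of_not_decides_zero T hP hr hj hl
      rw [h4, T.send_idle _ _ _ h1 h2 h3]
    · rw [if_neg fun h => hl (mem_waitingSenders.1 h).2]
      push Not at hl
      obtain ⟨k, hk, hz⟩ := hl
      rcases hk.eq_or_lt with rfl | hlt
      · obtain ⟨k', hk', hz'⟩ := decides_zero_of_hears T hP hr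
          (show γ.Hears P r i (k + 1) from ⟨l, received_mem_of_decides hz hd⟩)
        exact (hi k' hk' hz').elim
      · have hdec := decided_ne_none_of_decides hP hr hz hlt
        have hnoop : P l ((r m).loc l) = .noop := by
          rw [implements_P0_eq hP hr m l, if_pos hdec]
        rw [hnoop, T.send_decided _ _ _ hdec]
  · rw [if_neg hd, if_neg fun h => hd (mem_waitingSenders.1 h).1]

theorem loc_eq_of_not_decides_zero (hr : r ∈ system γ.E γ.failures P)
    (hr' : r' ∈ system γ.E γ.failures P) {j' : Fin n} (hj : γ.Decides P r j 0 m)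
    (hj' : γ.Decides P r' j' 0 m) (hi : ∀ k ≤ m + 1, ¬ γ.Decides P r i 0 k)
    (hi' : ∀ k ≤ m + 1, ¬ γ.Decides P r' i 0 k)
    (hcard : (waitingSenders P r m i).card = (waitingSenders P r' m i).card) :
    (r (m + 1)).loc i = (r' (m + 1)).loc i := by
  obtain ⟨h1, h2, -, h4⟩ := waiting_of_not_decides_zero T hP hr hj fun k hk => hi k (by omega)
  obtain ⟨h1', h2', -, h4'⟩ := waiting_of_not_decides_zero T hP hr' hj' fun k hk => hi' k (by omega)
  rw [loc_succ_of_mem_system hr, loc_succ_of_mem_system hr', h4, h4',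
    received_eq_of_not_decides_zero T hP hr hj hi, received_eq_of_not_decides_zero T hP hr' hj' hi']
  exact T.update_quiet _ _ _ _ _ ((time_eq hr m i).trans (time_eq hr' m i).symm)
    (h1.trans h1'.symm) h2 h2' hcard

/-- At a positive time such an agent was waiting and has just heard a 0, so `update_heard` leaves
one possible state; at time 0 the preference determines it. -/
theorem loc_eq_of_decides_zero (hr : r ∈ system γ.E γ.failures P)
    (hr' : r' ∈ system γ.E γ.failures P) (hi : γ.Decides P r i 0 m) (hi' : γ.Decides P r' i 0 m) :
    (r m).loc i = (r' m).loc i := by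
  have hh := hears_of_decides_zero T hP hr hi
  have hh' := hears_of_decides_zero T hP hr' hi'
  cases m with
  | zero => exact T.initial_ext i _ (hr.2.1 i) _ (hr'.2.1 i) (Eq.trans hh (Eq.symm hh'))
  | succ m =>
    have key : ∀ r ∈ system γ.E γ.failures P, γ.Decides P r i 0 (m + 1) →
        (γ.coreAt r m i).init = 1 ∧ (γ.coreAt r m i).decided = none ∧
          P i ((r m).loc i) = .noop := by
      intro r hr hi
      obtain ⟨j, hj⟩ := hears_of_decides_zero T hP hr hi
      obtain ⟨h1, h2, -, h4⟩ := waiting_of_not_decides_zero T hP hr (decides_of_received_mem hj).1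
        fun k hk h => by have := decides_time_unique hP hr h hi; omega
      exact ⟨h1, h2, h4⟩
    obtain ⟨h1, h2, h4⟩ := key r hr hi
    obtain ⟨h1', h2', h4'⟩ := key r' hr' hi'
    rw [loc_succ_of_mem_system hr, loc_succ_of_mem_system hr', h4, h4']
    exact T.update_heard _ _ _ _ _ ((time_eq hr m i).trans (time_eq hr' m i).symm)
      (h1.trans h1'.symm) h2 h2' hh hh'

/-! ### Runs with a prescribed `0`-chain -/

omit hP in
/-- The global state in which only `c 0` has initial preference `0`, the agents in `S` are
nonfaulty, and the others omit all messages except those from `c k` to `c (k + 1)` in round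
`k + 1`, for `k < p`. -/
noncomputable def chainStart (T : LimitedExchange γ t) (c : ℕ → Fin n) (p : ℕ)
    (S : Finset (Fin n)) : GlobalState γ.E where
  env :=
    { nonfaulty := S
      delivered := fun k j l => decide (j ∈ S ∨ k < p ∧ j = c k ∧ l = c (k + 1)) }
  loc i := (T.exists_initial i (if i = c 0 then 0 else 1)).choose

variable {c : ℕ → Fin n} {p : ℕ} {S : Finset (Fin n)}

omit hP in
theorem chainStart_mem_system (hS : Sᶜ.card ≤ t) :
    runFrom P (chainStart T c p S) ∈ system γ.E γ.failures P := by
  refine runFrom_mem_system ?_ fun i => (T.exists_initial i _).choose_spec.1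
  rw [T.failures_eq]
  refine ⟨hS, fun m i j h hi => ?_⟩
  simp only [chainStart, decide_eq_false_iff_not] at h
  exact h (.inl hi)

omit hP in
theorem delivered_chainStart (hS : Sᶜ.card ≤ t) {k : ℕ} {j l : Fin n} :
    (runFrom P (chainStart T c p S) k).env.delivered k j l = true ↔
      j ∈ S ∨ k < p ∧ j = c k ∧ l = c (k + 1) := by
  rw [env_eq_of_mem_system (chainStart_mem_system T hS)]
  exact decide_eq_true_iff

/-- Before time `p` the only decider of 0 is the current chain member, which lies outside `S` and so
reaches only its successor. Injectivity of `c` prevents the successor from having decided earlier.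
-/
theorem decides_zero_chainStart (hS : Sᶜ.card ≤ t) (hc : Set.InjOn c (Set.Iic p))
    (hcS : ∀ k < p, c k ∉ S) {k : ℕ} (hk : k ≤ p) (l : Fin n) :
    γ.Decides P (runFrom P (chainStart T c p S)) l 0 k ↔ l = c k := by
  have hr : runFrom P (chainStart T c p S) ∈ system γ.E γ.failures P := chainStart_mem_system T hS
  induction k using Nat.strong_induction_on generalizing l with
  | _ k ih =>
  have hinit : γ.Hears P (runFrom P (chainStart T c p S)) l 0 ↔ l = c 0 := by
    change (γ.core l (T.exists_initial l _).choose).init = 0 ↔ _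
    rw [(T.exists_initial l _).choose_spec.2]
    split_ifs with h <;> simp [h]
  cases k with
  | zero =>
    rw [← hinit]
    refine ⟨hears_of_decides_zero T hP hr, fun h => ?_⟩
    obtain ⟨k, hk, hz⟩ := decides_zero_of_hears T hP hr h
    rwa [Nat.le_zero.1 hk] at hz
  | succ k =>
    constructor
    · intro h
      obtain ⟨j, hj⟩ := hears_of_decides_zero T hP hr h
      obtain ⟨hj, hd⟩ := decides_of_received_mem hj
      obtain rfl := (ih k k.lt_succ_self (by omega) j).1 hj
      rcases (delivered_chainStart T hS).1 hd with h | h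
      · exact (hcS k (by omega) h).elim
      · exact h.2.2
    · rintro rfl
      obtain ⟨k', hk', hz⟩ := decides_zero_of_hears T hP hr
        (show γ.Hears P (runFrom P (chainStart T c p S)) (c (k + 1)) (k + 1) from
          ⟨c k, received_mem_of_decides ((ih k k.lt_succ_self (by omega) _).2 rfl)
            ((delivered_chainStart T hS).2 (.inr ⟨by omega, rfl, rfl⟩))⟩)
      rcases hk'.eq_or_lt with rfl | hlt
      · exact hz
      · have := hc (Set.mem_Iic.2 hk) (Set.mem_Iic.2 (by omega))
          ((ih k' hlt (by omega) _).1 hz)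
        omega

/-! ### The second condition of safety -/

/-- The agents of a chain from which `i` has not heard by time `m` are faulty. -/
theorem card_image_chain_le (hr : r ∈ system γ.E γ.failures P)
    (hc : ∀ k < m, γ.Decides P r (c k) 0 k) (hi : ∀ k ≤ m, ¬ γ.Decides P r i 0 k) :
    ((Finset.range m).image c).card ≤ t := by
  have hF : (r 0).env ∈ SO n t := T.failures_eq ▸ hr.1
  refine (Finset.card_le_card fun l hl => ?_).trans hF.1
  obtain ⟨k, hk, rfl⟩ := Finset.mem_image.1 hl
  rw [Finset.mem_range] at hk
  rw [Finset.mem_compl]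
  intro hn
  have hd : (r k).env.delivered k (c k) i = true := by
    rw [env_eq_of_mem_system hr]
    by_contra h
    exact hF.2 k (c k) i (by simpa using h) hn
  obtain ⟨k', hk', hz⟩ := decides_zero_of_hears T hP hr
    (show γ.Hears P r i (k + 1) from ⟨c k, received_mem_of_decides (hc k hk) hd⟩)
  exact hi k' (by omega) hz

omit T in
theorem injOn_of_decides (hr : r ∈ system γ.E γ.failures P)
    (hc : ∀ k ≤ m, γ.Decides P r (c k) 0 k) : Set.InjOn c (Set.Iic m) := by
  intro a ha b hb hab
  have h := hc a ha
  rw [hab] at h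
  exact decides_time_unique hP hr h (hc b hb)

/-- The chain members before the last two did not reach `i`, which would have decided earlier, so
there are at most `t` of them. Making exactly these faulty leaves the last two nonfaulty. -/
theorem exists_nonfaulty_of_decides_zero (hr : r ∈ system γ.E γ.failures P)
    (hi : γ.Decides P r i 0 (m + 1)) :
    ∃ r' ∈ system γ.E γ.failures P, ∃ j : Fin n, i ∈ r'.nonfaulty ∧ j ∈ r'.nonfaulty ∧
      (r (m + 1)).loc i = (r' (m + 1)).loc i ∧ γ.Decides P r' j 0 m := by
  obtain ⟨c, rfl, -, hd, -⟩ := exists_chain T hP hr hi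
  have hinj := injOn_of_decides hP hr hd
  have hne : ∀ a b, a ≤ m + 1 → b ≤ m + 1 → a ≠ b → c a ≠ c b :=
    fun a b ha hb hab h => hab (hinj ha hb h)
  set S : Finset (Fin n) := ((Finset.range m).image c)ᶜ with hSdef
  have hmem : ∀ k, m ≤ k → k ≤ m + 1 → c k ∈ S := by
    intro k h1 h2
    simp only [hSdef, Finset.mem_compl, Finset.mem_image, Finset.mem_range, not_exists, not_and]
    exact fun a ha => hne a k (by omega) (by omega) (by omega)
  have hS : Sᶜ.card ≤ t := by
    rw [hSdef, compl_compl]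
    refine card_image_chain_le T hP (i := c (m + 1)) hr (fun k hk => hd k (by omega)) fun k hk h => ?_
    have := decides_time_unique hP hr h hi
    omega
  have hcS : ∀ k < m, c k ∉ S := fun k hk => by
    simp only [hSdef, Finset.mem_compl, not_not]
    exact Finset.mem_image_of_mem c (Finset.mem_range.2 hk)
  have hr' : runFrom P (chainStart T c m S) ∈ system γ.E γ.failures P := chainStart_mem_system T hS
  have hiff := fun k hk => decides_zero_chainStart (P := P) T hP hS
    (hinj.mono (Set.Iic_subset_Iic.2 m.le_succ)) hcS (k := k) hk
  have hm := (hiff m le_rfl _).2 rfl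
  refine ⟨_, hr', c m, hmem _ m.le_succ le_rfl, hmem _ le_rfl m.le_succ, ?_, hm⟩
  refine loc_eq_of_decides_zero T hP hr hr' hi ?_
  obtain ⟨k, hk, hz⟩ := decides_zero_of_hears T hP hr'
    (show γ.Hears P (runFrom P (chainStart T c m S)) (c (m + 1)) (m + 1) from
      ⟨c m, received_mem_of_decides hm
        ((delivered_chainStart T hS).2 (.inl (hmem _ le_rfl m.le_succ)))⟩)
  rcases hk.eq_or_lt with rfl | hlt
  · exact hz
  · exact (hne (m + 1) k le_rfl hk (by omega) ((hiff k (by omega) _).1 hz)).elim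

theorem exists_nonfaulty_of_decides_zero_init (hr : r ∈ system γ.E γ.failures P)
    (hj : γ.Decides P r j 0 0) :
    ∃ r' ∈ system γ.E γ.failures P, (r 0).loc i = (r' 0).loc i ∧ i ∈ r'.nonfaulty ∧
      ∃ j ∈ r'.nonfaulty, γ.Decides P r' j 0 0 := by
  have hS : (Finset.univ : Finset (Fin n))ᶜ.card ≤ t := by simp
  -- A chain of length 0 without failures: only `l` prefers 0.
  have key : ∀ l : Fin n, γ.Decides P (runFrom P (chainStart T (fun _ => l) 0 Finset.univ)) l 0 0 :=
    fun l => (decides_zero_chainStart (c := fun _ => l) T hP hS (by simp [Set.InjOn]) (by simp)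
      le_rfl l).2 rfl
  by_cases hi : γ.Decides P r i 0 0
  · exact ⟨_, chainStart_mem_system T hS,
      loc_eq_of_decides_zero T hP hr (chainStart_mem_system T hS) hi (key i),
      Finset.mem_univ _, i, Finset.mem_univ _, key i⟩
  · have hr' : runFrom P (chainStart T (fun _ => j) 0 Finset.univ) ∈ system γ.E γ.failures P :=
      chainStart_mem_system T hS
    refine ⟨_, hr', ?_, Finset.mem_univ _, j, Finset.mem_univ _, key j⟩
    refine T.initial_ext i _ (hr.2.1 i) _ (hr'.2.1 i) ?_
    have h1 := init_eq_one_of_not_decides_zero T hP hr hi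
    have hij : i ≠ j := fun h => hi (h ▸ hj)
    refine h1.trans (Eq.symm ?_)
    refine (T.exists_initial i _).choose_spec.2.trans ?_
    rw [if_neg hij]

theorem exists_nonfaulty_of_not_decides_zero (hnt : t + 2 ≤ n)
    (hr : r ∈ system γ.E γ.failures P) (hj : γ.Decides P r j 0 (m + 1))
    (hi : ∀ k ≤ m + 1, ¬ γ.Decides P r i 0 k) :
    ∃ r' ∈ system γ.E γ.failures P, (r (m + 1)).loc i = (r' (m + 1)).loc i ∧ i ∈ r'.nonfaulty ∧
      ∃ j ∈ r'.nonfaulty, γ.Decides P r' j 0 (m + 1) := by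
  have hF : (r 0).env ∈ SO n t := T.failures_eq ▸ hr.1
  obtain ⟨c, rfl, -, hd, -⟩ := exists_chain T hP hr hj
  have hinj := injOn_of_decides hP hr hd
  have hne : ∀ a b, a ≤ m + 1 → b ≤ m + 1 → a ≠ b → c a ≠ c b :=
    fun a b ha hb hab h => hab (hinj ha hb h)
  have hic : ∀ k ≤ m + 1, i ≠ c k := fun k hk h => hi k hk (h ▸ hd k hk)
  set W := waitingSenders P r m i with hW
  have hWcard : Wᶜ.card ≤ t := by
    refine (Finset.card_le_card fun l hl => ?_).trans hF.1
    rw [Finset.mem_compl] at hl ⊢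
    intro hn
    have hdel : ∀ k, (r k).env.delivered k l i = true := by
      intro k
      rw [env_eq_of_mem_system hr]
      by_contra h
      exact hF.2 k l i (by simpa using h) hn
    refine hl (mem_waitingSenders.2 ⟨hdel m, fun k hk hz => ?_⟩)
    obtain ⟨k', hk', hz'⟩ := decides_zero_of_hears T hP hr
      (show γ.Hears P r i (k + 1) from ⟨l, received_mem_of_decides hz (hdel k)⟩)
    exact hi k' (by omega) hz'
  -- This is where `t + 2 ≤ n` enters: `W` is large enough for `S` to hold both `i` and `c (m + 1)`.
  have hWtwo : 2 ≤ W.card := by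
    rw [Finset.card_compl, Fintype.card_fin] at hWcard
    omega
  have hWsub : W ⊆ ((Finset.range (m + 1)).image c)ᶜ := by
    intro l hl
    simp only [Finset.mem_compl, Finset.mem_image, Finset.mem_range, not_exists, not_and]
    rintro k hk rfl
    exact (mem_waitingSenders.1 hl).2 k (by omega) (hd k (by omega))
  have hpair : ({i, c (m + 1)} : Finset (Fin n)) ⊆ ((Finset.range (m + 1)).image c)ᶜ := by
    intro l hl
    simp only [Finset.mem_insert, Finset.mem_singleton] at hl
    simp only [Finset.mem_compl, Finset.mem_image, Finset.mem_range, not_exists, not_and]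
    rcases hl with rfl | rfl
    · exact fun k hk h => hic k (by omega) h.symm
    · exact fun k hk => hne k _ (by omega) le_rfl (by omega)
  obtain ⟨S, hpS, hSsub, hScard⟩ := Finset.exists_subsuperset_card_eq hpair
    (Finset.card_le_two.trans hWtwo) (Finset.card_le_card hWsub)
  have hS : Sᶜ.card ≤ t := by
    rw [Finset.card_compl, hScard, ← Finset.card_compl]
    exact hWcard
  have hcS : ∀ k < m + 1, c k ∉ S := fun k hk h =>
    Finset.mem_compl.1 (hSsub h) (Finset.mem_image_of_mem c (Finset.mem_range.2 hk))
  have hiS : i ∈ S := hpS (by simp)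
  have hjS : c (m + 1) ∈ S := hpS (by simp)
  have hr' : runFrom P (chainStart T c (m + 1) S) ∈ system γ.E γ.failures P :=
    chainStart_mem_system T hS
  have hiff := fun k hk => decides_zero_chainStart (P := P) T hP hS hinj hcS (k := k) hk
  refine ⟨_, hr', ?_, hiS, c (m + 1), hjS, (hiff _ le_rfl _).2 rfl⟩
  refine loc_eq_of_not_decides_zero T hP hr hr' (hd m m.le_succ) ((hiff m m.le_succ _).2 rfl) hi
    (fun k hk h => hic k hk ((hiff k hk _).1 h)) ?_
  rw [← hW, ← hScard]
  congr 1
  -- The waiting senders of the rebuilt run are exactly `S`: the others deliver only to the next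
  -- chain member, which is never `i`.
  ext l
  rw [mem_waitingSenders, delivered_chainStart T hS]
  constructor
  · intro hl
    refine ⟨.inl hl, fun k hk h => ?_⟩
    rw [hiff k (by omega)] at h
    exact hcS k (by omega) (h ▸ hl)
  · rintro ⟨h | h, -⟩
    · exact h
    · exact (hic _ le_rfl h.2.2).elim

theorem exists_nonfaulty_of_not_knowNoneDecidingZero (hnt : t + 2 ≤ n)
    (hr : r ∈ system γ.E γ.failures P)
    (hk : (γ.interpretedSystem P).Sat (.neg (γ.knowNoneDecidingZero i)) r m)
    (hi : ∀ k < m, ∀ v, ¬ γ.Decides P r i v k) :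
    ∃ r' ∈ system γ.E γ.failures P, (r m).loc i = (r' m).loc i ∧ i ∈ r'.nonfaulty ∧
      ∃ j ∈ r'.nonfaulty, γ.Decides P r' j 0 m := by
  have hk' : ¬ ∀ r' ∈ system γ.E γ.failures P, ∀ m', (r m).loc i = (r' m').loc i →
      ∀ j, ¬ (γ.interpretedSystem P).Sat (γ.decidingEq j 0) r' m' := hk
  push Not at hk'
  obtain ⟨r₁, hr₁, m₁, e, j, hj⟩ := hk'
  replace hj := decides_of_sat_decidingEq hr₁ hj
  -- Knowledge ranges over points at all times, but the local state contains the time.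
  obtain rfl : m = m₁ := by rw [← time_eq hr m i, ← time_eq hr₁ m₁ i, coreAt, coreAt, e]
  have hnone : (γ.coreAt r₁ m i).decided = none := by
    rw [coreAt, ← e]
    exact decided_eq_none hr hi
  rw [e]
  cases m with
  | zero => exact exists_nonfaulty_of_decides_zero_init T hP hr₁ hj
  | succ m =>
    by_cases hz : γ.Decides P r₁ i 0 (m + 1)
    -- Here `i` itself serves as the nonfaulty decider of 0.
    · obtain ⟨r', hr', -, hi', -, e', -⟩ := exists_nonfaulty_of_decides_zero T hP hr₁ hz
      refine ⟨r', hr', e', hi', i, hi', ?_⟩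
      unfold Decides at hz ⊢
      rwa [← e']
    · refine exists_nonfaulty_of_not_decides_zero T hP hnt hr₁ hj fun k hk h => ?_
      rcases hk.eq_or_lt with rfl | hlt
      · exact hz h
      · exact decided_ne_none_of_decides hP hr₁ h hlt hnone

end Implementation

theorem safe_P0 (T : LimitedExchange γ t) (hnt : t + 2 ≤ n) : γ.Safe γ.P0 := by
  intro P hP r hr m i
  refine ⟨exists_init_one_of_not_receivesZeroChain T hP hr, fun hk hi => ?_⟩
  obtain ⟨r', hr', e, hi', j, hj, hz⟩ :=
    exists_nonfaulty_of_not_knowNoneDecidingZero T hP hnt hr hk hi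
  refine ⟨r', hr', e, hi', j, hj, hz, fun hm => ?_⟩
  obtain ⟨m, rfl⟩ := Nat.exists_eq_add_of_le' hm
  obtain ⟨r'', hr'', j', h⟩ := exists_nonfaulty_of_decides_zero T hP hr' hz
  exact ⟨r'', hr'', j', h⟩

end EBAContext

/-! ### The minimal and the basic contexts -/

/-- A received 0 takes precedence in `rd`, so whether a 1 arrives matters only when no 0 does. -/
theorem Core.update_congr {s s' : Core} {a : Action} {got got' : Fin 2 → Bool}
    (ht : s.time = s'.time) (hi : s.init = s'.init) (hd : s.decided = s'.decided)
    (hg : got 0 = got' 0) (h1 : got 0 = true ∨ got 1 = got' 1) :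
    s.update a got = s'.update a got' := by
  unfold Core.update
  rw [ht, hi, hd, ← hg]
  congr 1
  split_ifs <;> simp_all

theorem Core.update_rd_zero {s : Core} {a : Action} {got : Fin 2 → Bool} (h : got 0 = true) :
    (s.update a got).rd = some 0 := by
  simp [Core.update, h]

/-- The minimal context exchanges little information. -/
def limitedExchange_minContext (n t : ℕ) : (minContext n t).LimitedExchange t where
  failures_eq := rfl
  exists_initial _ v := ⟨(⟨0, v, none, none⟩ : Core), ⟨rfl, rfl, rfl⟩, rfl⟩
  initial_ext := by
    rintro _ ⟨_, _, _, _⟩ ⟨rfl, rfl, rfl⟩ ⟨_, _, _, _⟩ ⟨rfl, rfl, rfl⟩ h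
    exact congrArg (fun v => (⟨0, v, none, none⟩ : Core)) h
  rd_zero i s a ρ j h := Core.update_rd_zero (gotMsg_iff.2 ⟨j, h⟩)
  send_decided _ _ _ _ := rfl
  idle _ := none
  send_idle _ _ _ _ _ _ := rfl
  update_heard i s s' ρ ρ' ht hi hd hd' h h' := by
    have e : gotMsg (M := Fin 2) ρ 0 = true := gotMsg_iff.2 h
    have e' : gotMsg (M := Fin 2) ρ' 0 = true := gotMsg_iff.2 h'
    exact Core.update_congr (a := .noop) (got := gotMsg (M := Fin 2) ρ)
      (got' := gotMsg (M := Fin 2) ρ') ht hi (hd.trans hd'.symm) (e.trans e'.symm) (.inl e)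
  update_quiet i s s' S S' ht hi hd hd' _ := by
    have e : (fun j => if j ∈ S then (none : Option (Fin 2)) else none) =
        fun j => if j ∈ S' then (none : Option (Fin 2)) else none := by
      simp only [ite_self]
    exact Core.update_congr (a := .noop)
      (got := gotMsg (M := Fin 2) fun j => if j ∈ S then none else none)
      (got' := gotMsg (M := Fin 2) fun j => if j ∈ S' then none else none)
      ht hi (hd.trans hd'.symm) (by rw [e]) (.inr (by rw [e]))

theorem gotMsg_idle {S : Finset (Fin n)} {v : Fin 2} :
    gotMsg (fun j => if j ∈ S then some BasicMsg.init1 else none) (.val v) = false := by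
  rw [← Bool.not_eq_true, gotMsg_iff]
  rintro ⟨j, hj⟩
  split_ifs at hj
  simp at hj

theorem countInit1_idle {S : Finset (Fin n)} :
    (countInit1 (fun j => if j ∈ S then some BasicMsg.init1 else none) : ℕ) = S.card := by
  simp [countInit1]

/-- The message 0 resets `ones`, so the count reveals nothing about the other messages of the round.
-/
theorem basicExchange_update_heard {i : Fin n} {s s' : BasicState n}
    {ρ ρ' : Fin n → Option BasicMsg} (ht : s.time = s'.time) (hi : s.init = s'.init)
    (hd : s.decided = none) (hd' : s'.decided = none)
    (h : ∃ j, ρ j = some (.val 0)) (h' : ∃ j, ρ' j = some (.val 0)) :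
    (basicExchange n).update i s .noop ρ = (basicExchange n).update i s' .noop ρ' := by
  have e := gotMsg_iff.2 h
  have e' := gotMsg_iff.2 h'
  have hc : basicCore s .noop ρ = basicCore s' .noop ρ' :=
    Core.update_congr ht hi (hd.trans hd'.symm) (e.trans e'.symm) (.inl e)
  change BasicState.mk _ _ = BasicState.mk _ _
  rw [hc, if_neg fun H => H.2 (h.imp fun _ hj => ⟨0, hj⟩),
    if_neg fun H => H.2 (h'.imp fun _ hj => ⟨0, hj⟩)]

theorem basicExchange_update_congr {i : Fin n} {s s' : BasicState n} {a : Action}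
    {ρ ρ' : Fin n → Option BasicMsg} (hc : basicCore s a ρ = basicCore s' a ρ')
    (hv : ¬ ∃ j v, ρ j = some (.val v)) (hv' : ¬ ∃ j v, ρ' j = some (.val v))
    (hn : countInit1 ρ = countInit1 ρ') :
    (basicExchange n).update i s a ρ = (basicExchange n).update i s' a ρ' := by
  change BasicState.mk _ _ = BasicState.mk _ _
  simp only [hc, hn, hv, hv']

theorem basicExchange_update_quiet {i : Fin n} {s s' : BasicState n} {S S' : Finset (Fin n)}
    (ht : s.time = s'.time) (hi : s.init = s'.init)
    (hd : s.decided = none) (hd' : s'.decided = none) (hS : S.card = S'.card) :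
    (basicExchange n).update i s .noop (fun j => if j ∈ S then some BasicMsg.init1 else none) =
      (basicExchange n).update i s' .noop
        (fun j => if j ∈ S' then some BasicMsg.init1 else none) := by
  have hc : basicCore s .noop (fun j => if j ∈ S then some BasicMsg.init1 else none) =
      basicCore s' .noop (fun j => if j ∈ S' then some BasicMsg.init1 else none) :=
    Core.update_congr ht hi (hd.trans hd'.symm) (by rw [gotMsg_idle, gotMsg_idle])
      (.inr (by rw [gotMsg_idle, gotMsg_idle]))
  have hv : ∀ S : Finset (Fin n),
      ¬ ∃ j v, (if j ∈ S then some BasicMsg.init1 else none) = some (BasicMsg.val v) := by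
    rintro S ⟨j, v, hj⟩
    split_ifs at hj
    simp at hj
  have hn : countInit1 (fun j => if j ∈ S then some BasicMsg.init1 else none) =
      countInit1 (fun j => if j ∈ S' then some BasicMsg.init1 else none) :=
    Fin.ext (by rw [countInit1_idle, countInit1_idle, hS])
  exact basicExchange_update_congr hc (hv S) (hv S') hn

/-- The basic context exchanges little information. -/
def limitedExchange_basicContext (n t : ℕ) : (basicContext n t).LimitedExchange t where
  failures_eq := rfl
  exists_initial _ v :=
    ⟨({ time := 0, init := v, decided := none, rd := none, ones := 0 } : BasicState n),
      ⟨rfl, rfl, rfl, rfl⟩, rfl⟩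
  initial_ext := by
    rintro _ ⟨⟨_, _, _, _⟩, _⟩ ⟨rfl, rfl, rfl, rfl⟩ ⟨⟨_, _, _, _⟩, _⟩ ⟨rfl, rfl, rfl, rfl⟩ h
    exact congrArg (fun v =>
      ({ time := 0, init := v, decided := none, rd := none, ones := 0 } : BasicState n)) h
  rd_zero i s a ρ j h := Core.update_rd_zero (gotMsg_iff.2 ⟨j, h⟩)
  send_decided i s j h := if_neg fun h' => h h'.2.1
  idle _ := some BasicMsg.init1
  send_idle i s j h1 h2 h3 := if_pos ⟨h1, h2, h3⟩
  update_heard _ _ _ _ _ := basicExchange_update_heard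
  update_quiet _ _ _ _ _ := basicExchange_update_quiet

end EBA

theorem mainTheorem5 (n t : ℕ) (hnt : t + 2 ≤ n) :
    (EBA.minContext n t).Safe (EBA.minContext n t).P0 ∧
      (EBA.basicContext n t).Safe (EBA.basicContext n t).P0 :=
  ⟨EBA.EBAContext.safe_P0 (EBA.limitedExchange_minContext n t) hnt,
    EBA.EBAContext.safe_P0 (EBA.limitedExchange_basicContext n t) hnt⟩
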